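/- For a function $U$ on $(0,\pi)$ let $(-\Delta)_s^{1/2}U(s)$ denote (with $L=1$) the half Laplacian of $u(x)=U(\operatorname{acot} x)$ at the point $x=\cot s$, where $\operatorname{acot}$ takes values in $(0,\pi)$ and $$(-\Delta)^{1/2}u(x)=\frac1\pi\,\mathrm{PV}\!\int_{-\infty}^{\infty}\frac{u(x)-u(x+y)}{|y|^{2}}\,dy .$$ (In particular $(-\Delta)_s^{1/2}U(s)$ is $\pi$-periodic in $s$.) Let $k$ be an odd natural number and $s\in(-\pi,0)\cup(0,\pi)$. Then the principal values defining $(-\Delta)_s^{1/2}\cos(ks)$ and $(-\Delta)_s^{1/2}\sin(ks)$ exist, and $$(-\Delta)_s^{1/2}\cos(ks)=\frac{2k}{\pi}\sin(ks)\left(\cos s+\sin^2 s\,\ln\left|\cot\frac s2\right|\right)+\frac{8k}{\pi}\sum_{n=0}^{(k-1)/2}\frac{\sin((k-1-2n)s)}{(2n-1)(2n+1)(2n+3)},$$ $$(-\Delta)_s^{1/2}\sin(ks)=-\frac{2}{\pi(k+2)}-\frac{2k}{\pi}\cos(ks)\left(\cos s+\sin^2 s\,\ln\left|\cot\frac s2\right|\right)-\frac{8k}{\pi}\sum_{n=0}^{(k-1)/2}\frac{\cos((k-1-2n)s)}{(2n-1)(2n+1)(2n+3)}.$$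 -/

import Mathlib

open Filter Topology MeasureTheory

/-- The normalising constant of the fractional Laplacian of order `α` on the real line,
`c_α = α 2^(α-1) Γ(1/2 + α/2) / (√π Γ(1 - α/2))`. -/
noncomputable def fracLaplConst (α : ℝ) : ℝ :=
  α * (2 : ℝ) ^ (α - 1) * Real.Gamma (1 / 2 + α / 2) / (Real.sqrt Real.pi * Real.Gamma (1 - α / 2))

/-- `HasFracLaplacianAt α u x v` says that `(-Δ)^(α/2) u (x)` exists and equals `v`, where
`(-Δ)^(α/2) u (x) = c_α PV ∫ (u(x) - u(x+y)) / |y|^(1+α) dy`: the integral converges absolutely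
away from `y = 0`, and `v` is the limit of the symmetric truncations around `y = 0`. -/
def HasFracLaplacianAt (α : ℝ) (u : ℝ → ℝ) (x v : ℝ) : Prop :=
  (∀ ε : ℝ, 0 < ε →
    IntegrableOn (fun y : ℝ => (u x - u (x + y)) / |y| ^ (1 + α)) {y : ℝ | ε < |y|}) ∧
  Tendsto
    (fun ε : ℝ => fracLaplConst α *
      ∫ y in {y : ℝ | ε < |y|}, (u x - u (x + y)) / |y| ^ (1 + α))
    (𝓝[>] 0) (𝓝 v)

/-- The inverse cotangent with values in `(0, π)`. -/
noncomputable def arccot (x : ℝ) : ℝ := Real.pi / 2 - Real.arctan x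

/-- `HasHalfLaplacianS L U s v` says that `(-Δ)_s^(1/2) U (s)` exists and equals `v`: it is the half
Laplacian, at the point `x = L cot s`, of the function `x ↦ U (arccot (x / L))` on the real line
(so it is `π`-periodic in `s` and depends only on `U` on `(0, π)`). -/
def HasHalfLaplacianS (L : ℝ) (U : ℝ → ℝ) (s v : ℝ) : Prop :=
  HasFracLaplacianAt 1 (fun x : ℝ => U (arccot (x / L))) (L * Real.cot s) v

/-! Both formulas are the real and imaginary parts of one for `u = exp (i k arccot)`, `k = 2m+1`,
whose truncated integrals have an elementary primitive. Put `x = cot s`, `θ = arccot (x + y)`, `φ =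
θ - s`. Integrating by parts leaves `(u (x+y) - u x) / y` and the integral of `-u' (x+y) / y`. Since
`sin φ = -y sin θ sin s` and `sin θ = sin φ cos s + cos φ sin s`, the latter is `i k sin s cos s ∫
e^{ikθ} dθ + i k sin² s e^{iks} ∫ cot φ e^{ikφ} dφ`. For odd `k`, `cos φ e^{ikφ} - 1` vanishes
wherever `sin φ` does, so the last integral is `log |tan (φ/2)|` plus an exponential polynomial
(`hasDerivAt_cotExpPrim`). This gives `quotPrim` and `hasDerivAt_quotPrim`. The singularity at `y =
0` is even and cancels in the principal value (`tendsto_quotPrim_neg_sub`), so only the values at `y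
= ±∞`, that is `θ = 0` and `θ = π`, remain. `sin_sq_mul_cotExpPrim` turns them into the stated sum.
-/

/-! ### Principal values from a primitive -/

theorem tendsto_setIntegral_lt_abs {f F : ℝ → ℂ} {A B : ℂ}
    (hf : ∀ ε : ℝ, 0 < ε → IntegrableOn f {y : ℝ | ε < |y|})
    (hF : ∀ y : ℝ, y ≠ 0 → HasDerivAt F (f y) y)
    (hA : Tendsto F atTop (𝓝 A)) (hB : Tendsto F atBot (𝓝 B))
    (h0 : Tendsto (fun ε : ℝ => F (-ε) - F ε) (𝓝[>] 0) (𝓝 0)) :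
    Tendsto (fun ε : ℝ => ∫ y in {y : ℝ | ε < |y|}, f y) (𝓝[>] 0) (𝓝 (A - B)) := by
  have key : ∀ ε : ℝ, 0 < ε →
      ∫ y in {y : ℝ | ε < |y|}, f y = (A - B) + (F (-ε) - F ε) := by
    intro ε hε
    have hset : {y : ℝ | ε < |y|} = Set.Iio (-ε) ∪ Set.Ioi ε := by
      ext y
      simp only [Set.mem_ofPred_eq, Set.mem_union, Set.mem_Iio, Set.mem_Ioi, lt_abs]
      constructor
      · rintro (h | h)
        · exact Or.inr h
        · exact Or.inl (by linarith)
      · rintro (h | h)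
        · exact Or.inr (by linarith)
        · exact Or.inl h
    have hi := hf ε hε
    rw [hset] at hi ⊢
    have hi1 := hi.mono_set Set.subset_union_left
    have hi2 := hi.mono_set Set.subset_union_right
    rw [setIntegral_union (Set.disjoint_left.2 fun y h1 h2 => by
      simp only [Set.mem_Iio, Set.mem_Ioi] at h1 h2; linarith) measurableSet_Ioi hi1 hi2,
      ← integral_Iic_eq_integral_Iio,
      integral_Iic_of_hasDerivAt_of_tendsto' (f := F) (m := B) (fun y hy => hF y ?_)
        (by rwa [integrableOn_Iic_iff_integrableOn_Iio]) hB,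
      integral_Ioi_of_hasDerivAt_of_tendsto' (f := F) (m := A) (fun y hy => hF y ?_) hi2 hA]
    · ring
    · exact (hε.trans_le hy).ne'
    · simp only [Set.mem_Iic] at hy
      exact ne_of_lt (by linarith)
  have : Tendsto (fun ε : ℝ => (A - B) + (F (-ε) - F ε)) (𝓝[>] 0) (𝓝 (A - B)) := by
    simpa using h0.const_add (A - B)
  refine this.congr' ?_
  filter_upwards [self_mem_nhdsWithin] with ε hε
  exact (key ε hε).symm

theorem integrableOn_sub_div_sq {u : ℝ → ℂ} (hu : Continuous u) (hb : ∀ t, ‖u t‖ ≤ 1) (x : ℝ)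
    {ε : ℝ} (hε : 0 < ε) :
    IntegrableOn (fun y : ℝ => (u x - u (x + y)) / (y : ℂ) ^ 2) {y : ℝ | ε < |y|} := by
  have hg : Integrable (fun y : ℝ => 2 * (1 / ε ^ 2 + 1) * (1 + y ^ 2)⁻¹) :=
    integrable_inv_one_add_sq.const_mul _
  refine hg.integrableOn.mono' ?_ ?_
  · have : Measurable u := hu.measurable
    exact Measurable.aestronglyMeasurable (by fun_prop)
  · refine (ae_restrict_iff' (measurableSet_lt measurable_const (by fun_prop))).2
      (Eventually.of_forall fun y hy => ?_)
    have hy' : ε ^ 2 ≤ y ^ 2 := by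
      rw [← sq_abs y]; exact pow_le_pow_left₀ hε.le (le_of_lt hy) 2
    have hε2 : 0 < ε ^ 2 := by positivity
    have hy0 : 0 < y ^ 2 := by linarith
    have h1 : ‖u x - u (x + y)‖ ≤ 2 := (norm_sub_le _ _).trans (by linarith [hb x, hb (x + y)])
    have h2 : (1 : ℝ) ≤ y ^ 2 / ε ^ 2 := by rwa [le_div_iff₀ hε2, one_mul]
    rw [norm_div, norm_pow, Complex.norm_real, Real.norm_eq_abs, sq_abs, mul_assoc,
      ← div_eq_mul_inv]
    calc ‖u x - u (x + y)‖ / y ^ 2 ≤ 2 / y ^ 2 := by gcongr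
      _ = 2 * (1 / y ^ 2) := by ring
      -- Because `|y| > ε`, `(1 + y²) / y² ≤ 1/ε² + 1`; this fixes the constant in the dominating
      -- function.
      _ ≤ 2 * ((1 / ε ^ 2 + 1) / (1 + y ^ 2)) := by
        gcongr 2 * ?_
        rw [div_le_div_iff₀ hy0 (by positivity)]
        have : (1 / ε ^ 2 + 1) * y ^ 2 = y ^ 2 / ε ^ 2 + y ^ 2 := by ring
        linarith

/-! ### The cotangent substitution -/

theorem arccot_mem_Ioo (x : ℝ) : arccot x ∈ Set.Ioo 0 Real.pi := by
  have h1 := Real.arctan_lt_pi_div_two x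
  have h2 := Real.neg_pi_div_two_lt_arctan x
  constructor <;> unfold arccot <;> linarith

theorem sin_arccot_pos (x : ℝ) : 0 < Real.sin (arccot x) :=
  Real.sin_pos_of_mem_Ioo (arccot_mem_Ioo x)

theorem cos_arccot (x : ℝ) : Real.cos (arccot x) = x * Real.sin (arccot x) := by
  rw [arccot, Real.cos_pi_div_two_sub, Real.sin_pi_div_two_sub, Real.cos_arctan, Real.sin_arctan]
  ring

theorem sin_arccot_sq (x : ℝ) : Real.sin (arccot x) ^ 2 = 1 / (1 + x ^ 2) := by
  rw [arccot, Real.sin_pi_div_two_sub, Real.cos_sq_arctan]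

theorem continuous_arccot : Continuous arccot :=
  continuous_const.sub Real.continuous_arctan

theorem hasDerivAt_arccot (x : ℝ) : HasDerivAt arccot (-Real.sin (arccot x) ^ 2) x := by
  rw [sin_arccot_sq]
  exact (Real.hasDerivAt_arctan x).const_sub _

theorem arccot_cot {s : ℝ} (hs : s ∈ Set.Ioo 0 Real.pi) : arccot (Real.cot s) = s := by
  rw [Real.cot_eq_cos_div_sin, ← Real.sin_pi_div_two_sub, ← Real.cos_pi_div_two_sub s,
    ← Real.tan_eq_sin_div_cos, arccot,
    Real.arctan_tan (by linarith [hs.2]) (by linarith [hs.1])]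
  ring

theorem tendsto_arccot_atTop : Tendsto arccot atTop (𝓝 0) := by
  have := (tendsto_nhds_of_tendsto_nhdsWithin Real.tendsto_arctan_atTop).const_sub (Real.pi / 2)
  rwa [sub_self] at this

theorem tendsto_arccot_atBot : Tendsto arccot atBot (𝓝 Real.pi) := by
  have := (tendsto_nhds_of_tendsto_nhdsWithin Real.tendsto_arctan_atBot).const_sub (Real.pi / 2)
  rwa [sub_neg_eq_add, add_halves] at this

/-- This is `cot θ - cot s = -sin (θ - s) / (sin θ sin s)`; it converts the kernel `1/y` into `1/sin
φ`. -/
theorem sin_arccot_cot_add_sub {s : ℝ} (hs : s ∈ Set.Ioo 0 Real.pi) (y : ℝ) :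
    Real.sin (arccot (Real.cot s + y) - s) =
      -(y * Real.sin (arccot (Real.cot s + y)) * Real.sin s) := by
  have h := Real.sin_pos_of_mem_Ioo hs
  rw [Real.sin_sub, cos_arccot, Real.cot_eq_cos_div_sin]
  field_simp
  ring

/-! ### Primitives of cosecant and of cotangent times an exponential -/

theorem one_add_cos_pos {x : ℝ} (h1 : -Real.pi < x) (h2 : x < Real.pi) : 0 < 1 + Real.cos x := by
  have h : 0 < Real.cos (x / 2) := Real.cos_pos_of_mem_Ioo ⟨by linarith, by linarith⟩
  have := Real.cos_sq (x / 2)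
  rw [mul_div_cancel₀ x two_ne_zero] at this
  nlinarith [pow_pos h 2]

/-- A real primitive of `1 / sin`. -/
noncomputable def logTanHalf (x : ℝ) : ℝ := Real.log (Real.sin x) - Real.log (1 + Real.cos x)

/-- Here `tan (x/2) = sin x / (1 + cos x)`. As `Real.log` is `log |·|`, negative `sin x` is covered
too, which is needed for both signs of `φ`. -/
theorem hasDerivAt_logTanHalf {x : ℝ} (h1 : Real.sin x ≠ 0) (h2 : 1 + Real.cos x ≠ 0) :
    HasDerivAt logTanHalf (1 / Real.sin x) x := by
  have := ((Real.hasDerivAt_sin x).log h1).sub (((Real.hasDerivAt_cos x).const_add 1).log h2)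
  refine this.congr_deriv ?_
  field_simp
  linear_combination Real.sin_sq_add_cos_sq x

/-- The exponential `x ↦ exp (i j x)` with natural frequency `j`. -/
noncomputable def expFreq (j : ℕ) (x : ℝ) : ℂ := Complex.exp ((j : ℂ) * x * Complex.I)

theorem hasDerivAt_expFreq (j : ℕ) (x : ℝ) :
    HasDerivAt (expFreq j) ((j : ℂ) * Complex.I * expFreq j x) x := by
  have h : HasDerivAt (fun x : ℝ => (j : ℂ) * x * Complex.I) ((j : ℂ) * 1 * Complex.I) x :=
    ((Complex.ofRealCLM.hasDerivAt (x := x)).const_mul (j : ℂ)).mul_const _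
  refine h.cexp.congr_deriv ?_
  rw [expFreq]; ring

theorem continuous_expFreq (j : ℕ) : Continuous (expFreq j) := by
  unfold expFreq; fun_prop

theorem expFreq_eq (j : ℕ) (x : ℝ) :
    expFreq j x = (Real.cos (j * x) : ℂ) + (Real.sin (j * x) : ℂ) * Complex.I := by
  rw [expFreq, Complex.exp_mul_I]; push_cast; rfl

theorem norm_expFreq (j : ℕ) (x : ℝ) : ‖expFreq j x‖ = 1 := by
  have := Complex.norm_exp_ofReal_mul_I (j * x)
  rw [expFreq]; push_cast at this; exact this

theorem expFreq_add (j : ℕ) (x y : ℝ) : expFreq j (x + y) = expFreq j x * expFreq j y := by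
  rw [expFreq, expFreq, expFreq, ← Complex.exp_add]; push_cast; ring_nf

theorem expFreq_add_freq (i j : ℕ) (x : ℝ) : expFreq (i + j) x = expFreq i x * expFreq j x := by
  rw [expFreq, expFreq, expFreq, ← Complex.exp_add]; push_cast; ring_nf

theorem expFreq_zero (j : ℕ) : expFreq j 0 = 1 := by simp [expFreq]

theorem expFreq_odd_pi (m : ℕ) : expFreq (2 * m + 1) Real.pi = -1 := by
  rw [expFreq_add_freq, expFreq_eq, expFreq_eq 1]
  have h1 : Real.cos ((2 * m : ℕ) * Real.pi) = 1 := by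
    rw [Nat.cast_mul, mul_comm ((2 : ℕ) : ℝ), mul_assoc]; exact Real.cos_nat_mul_two_pi m
  have h2 : Real.sin ((2 * m : ℕ) * Real.pi) = 0 := Real.sin_nat_mul_pi _
  rw [h1, h2]; simp

/-- The smooth part of a primitive of `cot x * exp (i (2m+1) x)`. -/
noncomputable def cotExpPrim (m : ℕ) (x : ℝ) : ℂ :=
  expFreq 1 x + ∑ j ∈ Finset.range m,
    (expFreq (2 * j + 3) x / (2 * j + 3) + expFreq (2 * j + 1) x / (2 * j + 1))

theorem cotExpPrim_succ (m : ℕ) (x : ℝ) :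
    cotExpPrim (m + 1) x = cotExpPrim m x +
      (expFreq (2 * m + 3) x / (2 * m + 3) + expFreq (2 * m + 1) x / (2 * m + 1)) := by
  rw [cotExpPrim, cotExpPrim, Finset.sum_range_succ, add_assoc]

theorem continuous_cotExpPrim (m : ℕ) : Continuous (cotExpPrim m) := by
  have := continuous_expFreq
  unfold cotExpPrim; fun_prop

theorem two_mul_add_one_ne (m : ℕ) : (2 * (m : ℂ) + 1) ≠ 0 := by
  exact_mod_cast (Nat.succ_ne_zero (2 * m))

theorem two_mul_add_three_ne (m : ℕ) : (2 * (m : ℂ) + 3) ≠ 0 := by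
  exact_mod_cast (Nat.succ_ne_zero (2 * m + 2))

/-- Telescoping in `m`: with `z = e^{ix}`, `cos x (z² - 1) = i sin x (z² + 1)`, so raising the
frequency by 2 adds two pure exponentials to the derivative. -/
theorem hasDerivAt_cotExpPrim (m : ℕ) {x : ℝ} (h : Real.sin x ≠ 0) :
    HasDerivAt (cotExpPrim m)
      ((Real.cos x * expFreq (2 * m + 1) x - 1) / (Real.sin x : ℂ)) x := by
  have hc : (Real.sin x : ℂ) ≠ 0 := by exact_mod_cast h
  have hsc : (Real.sin x : ℂ) ^ 2 + (Real.cos x : ℂ) ^ 2 = 1 := by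
    exact_mod_cast Real.sin_sq_add_cos_sq x
  induction m with
  | zero =>
    have h0 : cotExpPrim 0 = expFreq 1 := by ext t; simp [cotExpPrim]
    rw [h0]
    refine (hasDerivAt_expFreq 1 x).congr_deriv ?_
    rw [eq_div_iff hc, expFreq_eq]
    simp only [Nat.cast_one, one_mul]
    linear_combination (-1 : ℂ) * hsc + (Real.sin x : ℂ) ^ 2 * Complex.I_sq
  | succ m ih =>
    have hfun : cotExpPrim (m + 1) = fun x => cotExpPrim m x +
      (expFreq (2 * m + 3) x / (2 * m + 3) + expFreq (2 * m + 1) x / (2 * m + 1)) :=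
      funext (cotExpPrim_succ m)
    rw [hfun]
    refine (ih.add (((hasDerivAt_expFreq (2 * m + 3) x).div_const _).add
      ((hasDerivAt_expFreq (2 * m + 1) x).div_const _))).congr_deriv ?_
    have h1 := two_mul_add_one_ne m
    have h3 := two_mul_add_three_ne m
    have e1 : expFreq (2 * (m + 1) + 1) x = expFreq (2 * m + 1) x * expFreq 1 x ^ 2 := by
      rw [show 2 * (m + 1) + 1 = 2 * m + 1 + (1 + 1) by ring, expFreq_add_freq,
        expFreq_add_freq 1 1, sq]
    have e3 : expFreq (2 * m + 3) x = expFreq (2 * m + 1) x * expFreq 1 x ^ 2 := by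
      rw [← e1]; rfl
    rw [e1, e3]
    have ez : expFreq 1 x = (Real.cos x : ℂ) + (Real.sin x : ℂ) * Complex.I := by
      simpa using expFreq_eq 1 x
    generalize (Real.cos x : ℂ) = c at *
    generalize (Real.sin x : ℂ) = d at *
    rw [ez]
    push_cast
    have hz : Complex.I * d * ((c + d * Complex.I) ^ 2 + 1) = c * ((c + d * Complex.I) ^ 2 - 1) := by
      linear_combination (-(Complex.I * d + c)) * hsc
        + (Complex.I * d + c) * d ^ 2 * Complex.I_sq
    field_simp
    linear_combination expFreq (2 * m + 1) x * hz

/-! ### The explicit primitive and its limits -/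

/-- A primitive, in the variable `y`, of `(u x - u (x + y)) / y ^ 2`, where `x = cot s` and
`u t = exp (i (2m+1) arccot t)`. -/
noncomputable def quotPrim (m : ℕ) (s y : ℝ) : ℂ :=
  (expFreq (2 * m + 1) (arccot (Real.cot s + y)) - expFreq (2 * m + 1) s) / y
    + Real.sin s * Real.cos s * expFreq (2 * m + 1) (arccot (Real.cot s + y))
    + Real.sin s ^ 2 * ((2 * m + 1) * Complex.I) * expFreq (2 * m + 1) s *
      ((logTanHalf (arccot (Real.cot s + y) - s) : ℂ) + cotExpPrim m (arccot (Real.cot s + y) - s))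

theorem hasDerivAt_arccot_cot_add (s y : ℝ) :
    HasDerivAt (fun y => arccot (Real.cot s + y)) (-Real.sin (arccot (Real.cot s + y)) ^ 2) y := by
  simpa using (hasDerivAt_arccot (Real.cot s + y)).comp_const_add (Real.cot s) y

theorem hasDerivAt_quotPrim (m : ℕ) {s : ℝ} (hs : s ∈ Set.Ioo 0 Real.pi) {y : ℝ} (hy : y ≠ 0) :
    HasDerivAt (quotPrim m s)
      ((expFreq (2 * m + 1) s - expFreq (2 * m + 1) (arccot (Real.cot s + y))) / (y : ℂ) ^ 2) y := by
  have hθ := hasDerivAt_arccot_cot_add s y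
  have hm := arccot_mem_Ioo (Real.cot s + y)
  have hsin := sin_arccot_pos (Real.cot s + y)
  have hφ := sin_arccot_cot_add_sub hs y
  have hss := Real.sin_pos_of_mem_Ioo hs
  have hadd := expFreq_add (2 * m + 1) s (arccot (Real.cot s + y) - s)
  rw [add_sub_cancel] at hadd
  have hsinθ : Real.sin (arccot (Real.cot s + y)) =
      Real.sin (arccot (Real.cot s + y) - s) * Real.cos s
        + Real.cos (arccot (Real.cot s + y) - s) * Real.sin s := by
    rw [← Real.sin_add, sub_add_cancel]
  have hne : Real.sin (arccot (Real.cot s + y) - s) ≠ 0 := by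
    rw [hφ]; simp [hy, hsin.ne', hss.ne']
  have hc := one_add_cos_pos (x := arccot (Real.cot s + y) - s)
    (by linarith [hm.1, hs.2]) (by linarith [hm.2, hs.1])
  have hu := (hasDerivAt_expFreq (2 * m + 1) (arccot (Real.cot s + y))).scomp y hθ
  have hφ' := hθ.sub_const s
  have hL := ((hasDerivAt_logTanHalf hne hc.ne').comp y hφ').ofReal_comp
  have hP := (hasDerivAt_cotExpPrim m hne).scomp y hφ'
  have hyC : HasDerivAt (fun y : ℝ => (y : ℂ)) 1 y := Complex.ofRealCLM.hasDerivAt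
  have hyc : (y : ℂ) ≠ 0 := by exact_mod_cast hy
  have := (((hu.sub_const (expFreq (2 * m + 1) s)).div hyC hyc).add
    (hu.const_mul ((Real.sin s : ℂ) * Real.cos s))).add
    ((hL.add hP).const_mul
      ((Real.sin s : ℂ) ^ 2 * ((2 * m + 1) * Complex.I) * expFreq (2 * m + 1) s))
  refine this.congr_deriv ?_
  simp only [Function.comp_apply, Complex.real_smul, Complex.ofReal_mul, Complex.ofReal_div,
    Complex.ofReal_neg, Complex.ofReal_pow, Complex.ofReal_one]
  have hφc := congrArg Complex.ofReal hφ
  have hsc := congrArg Complex.ofReal hsinθ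
  have hnec : (Real.sin (arccot (Real.cot s + y) - s) : ℂ) ≠ 0 := by exact_mod_cast hne
  have hsinc : (Real.sin (arccot (Real.cot s + y)) : ℂ) ≠ 0 := by exact_mod_cast hsin.ne'
  simp only [Complex.ofReal_mul, Complex.ofReal_neg, Complex.ofReal_add] at hφc hsc
  rw [hadd] at *
  generalize (Real.sin (arccot (Real.cot s + y) - s) : ℂ) = a at *
  generalize (Real.cos (arccot (Real.cot s + y) - s) : ℂ) = b at *
  generalize (Real.sin (arccot (Real.cot s + y)) : ℂ) = t at *
  generalize (Real.sin s : ℂ) = d at *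
  generalize (Real.cos s : ℂ) = c at *
  generalize expFreq (2 * m + 1) (arccot (Real.cot s + y) - s) = E at *
  generalize expFreq (2 * m + 1) s = E' at *
  -- Eliminates `sin θ` between `sin φ = -y sin θ sin s` and the addition formula; every term left
  -- after the product rule is a multiple of it.
  have key : a + d * c * y * a + d ^ 2 * b * y = 0 := by
    linear_combination hφc - y * d * hsc
  push_cast
  field_simp
  linear_combination (-(t ^ 2 * E' * E * (2 * m + 1) * Complex.I * y)) * key

theorem tendsto_quotPrim_of_arccot (m : ℕ) {s T : ℝ} {l : Filter ℝ}
    (hl : Tendsto (fun y : ℝ => (y : ℂ)⁻¹) l (𝓝 0))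
    (hT : Tendsto (fun y => arccot (Real.cot s + y)) l (𝓝 T))
    (h1 : Real.sin (T - s) ≠ 0) (h2 : 1 + Real.cos (T - s) ≠ 0) :
    Tendsto (quotPrim m s) l (𝓝 (Real.sin s * Real.cos s * expFreq (2 * m + 1) T
      + Real.sin s ^ 2 * ((2 * m + 1) * Complex.I) * expFreq (2 * m + 1) s *
        ((logTanHalf (T - s) : ℂ) + cotExpPrim m (T - s)))) := by
  have hu := ((continuous_expFreq (2 * m + 1)).tendsto T).comp hT
  have hφ := hT.sub_const s
  have hL := (Complex.continuous_ofReal.tendsto _).comp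
    ((hasDerivAt_logTanHalf h1 h2).continuousAt.tendsto.comp hφ)
  have hP := ((continuous_cotExpPrim m).tendsto _).comp hφ
  have := (((hu.sub_const (expFreq (2 * m + 1) s)).mul hl).add
    (hu.const_mul ((Real.sin s : ℂ) * Real.cos s))).add
    ((hL.add hP).const_mul
      ((Real.sin s : ℂ) ^ 2 * ((2 * m + 1) * Complex.I) * expFreq (2 * m + 1) s))
  rw [mul_zero, zero_add] at this
  exact this

/-- Isolates the singularity as `log |y|`, which is even in `y`; the bracket is continuous at `y =
0`. -/
theorem logTanHalf_arccot_cot_add_sub {s : ℝ} (hs : s ∈ Set.Ioo 0 Real.pi) {y : ℝ} (hy : y ≠ 0) :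
    logTanHalf (arccot (Real.cot s + y) - s) =
      Real.log y + (Real.log (Real.sin (arccot (Real.cot s + y))) + Real.log (Real.sin s)
        - Real.log (1 + Real.cos (arccot (Real.cot s + y) - s))) := by
  have h1 := (sin_arccot_pos (Real.cot s + y)).ne'
  have h2 := (Real.sin_pos_of_mem_Ioo hs).ne'
  rw [logTanHalf, sin_arccot_cot_add_sub hs, Real.log_neg_eq_log, Real.log_mul (mul_ne_zero hy h1) h2,
    Real.log_mul hy h1]
  ring

theorem tendsto_quotPrim_neg_sub (m : ℕ) {s : ℝ} (hs : s ∈ Set.Ioo 0 Real.pi) :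
    Tendsto (fun ε : ℝ => quotPrim m s (-ε) - quotPrim m s ε) (𝓝[>] 0) (𝓝 0) := by
  set k := 2 * m + 1 with hk
  let θ : ℝ → ℝ := fun y => arccot (Real.cot s + y)
  have hθ0 : θ 0 = s := by simp only [θ, add_zero]; exact arccot_cot hs
  have hθc : Continuous θ := continuous_arccot.comp (by fun_prop)
  have hs0 := (Real.sin_pos_of_mem_Ioo hs).ne'
  have hu := (hasDerivAt_expFreq k (θ 0)).scomp 0 (hasDerivAt_arccot_cot_add s 0)
  -- `R` is `quotPrim` without the difference quotient and the `log |y|` term. The quotients at `±ε`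
  -- share the limit given by the derivative at `0`, and the logarithms cancel.
  let R : ℝ → ℂ := fun y =>
    Real.sin s * Real.cos s * expFreq k (θ y)
    + Real.sin s ^ 2 * ((2 * m + 1) * Complex.I) * expFreq k s *
      (((Real.log (Real.sin (θ y)) + Real.log (Real.sin s)
        - Real.log (1 + Real.cos (θ y - s)) : ℝ) : ℂ) + cotExpPrim m (θ y - s))
  have hR : ContinuousAt R 0 := by
    have h1 : Real.sin (θ 0) ≠ 0 := by rwa [hθ0]
    have h2 : 1 + Real.cos (θ 0 - s) ≠ 0 := by rw [hθ0]; norm_num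
    have e1 := continuous_expFreq k
    have e2 := continuous_cotExpPrim m
    have e3 : ContinuousAt (fun y => Real.log (Real.sin (θ y))) 0 :=
      ContinuousAt.log (by fun_prop) h1
    have e4 : ContinuousAt (fun y => Real.log (1 + Real.cos (θ y - s))) 0 :=
      ContinuousAt.log (by fun_prop) h2
    have e5 : ContinuousAt (fun y => ((Real.log (Real.sin (θ y)) + Real.log (Real.sin s)
        - Real.log (1 + Real.cos (θ y - s)) : ℝ) : ℂ)) 0 :=
      Complex.continuous_ofReal.continuousAt.comp ((e3.add continuousAt_const).sub e4)
    fun_prop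
  have hp : Tendsto (fun ε : ℝ => ε) (𝓝[>] 0) (𝓝[≠] 0) :=
    tendsto_id.mono_left (nhdsWithin_mono _ fun x (hx : 0 < x) => hx.ne')
  have hn : Tendsto (fun ε : ℝ => -ε) (𝓝[>] 0) (𝓝[≠] 0) := by
    refine tendsto_nhdsWithin_iff.2 ⟨?_, ?_⟩
    · simpa using (continuous_neg.tendsto (0 : ℝ)).mono_left nhdsWithin_le_nhds
    · filter_upwards [self_mem_nhdsWithin] with x hx
      exact neg_ne_zero.2 (ne_of_gt hx)
  have hslope := hasDerivAt_iff_tendsto_slope.1 hu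
  have h := ((hslope.comp hn).sub (hslope.comp hp)).add
    ((hR.tendsto.comp (hn.mono_right nhdsWithin_le_nhds)).sub
      (hR.tendsto.comp (hp.mono_right nhdsWithin_le_nhds)))
  rw [sub_self, sub_self, add_zero] at h
  refine h.congr' ?_
  filter_upwards [self_mem_nhdsWithin] with ε hε
  have hε0 : ε ≠ 0 := ne_of_gt hε
  simp only [Function.comp_apply, slope_def_module, sub_zero, Complex.real_smul, R, hθ0, quotPrim]
  rw [logTanHalf_arccot_cot_add_sub hs hε0, logTanHalf_arccot_cot_add_sub hs (neg_ne_zero.2 hε0),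
    Real.log_neg_eq_log, ← hk]
  simp only [θ, Complex.ofReal_add, Complex.ofReal_inv]
  push_cast
  ring

/-! ### Closed form of the boundary terms -/

/-- Induction on `m`: passing to `m + 1` multiplies both the product on the left and the sum by
`e^{2is}`, up to explicit terms. The new summand `n = m + 1` has frequency 0. -/
theorem sin_sq_mul_cotExpPrim (m : ℕ) (s : ℝ) :
    (Real.sin s : ℂ) ^ 2 * (expFreq (2 * m + 1) s * cotExpPrim m (-s)) =
      -(expFreq (2 * m + 1) s * Real.cos s) - 1 / ((2 * m + 1) * (2 * m + 3))
        - 4 * ∑ n ∈ Finset.range (m + 1), expFreq (2 * (m - n)) s /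
          ((2 * n - 1) * (2 * n + 1) * (2 * n + 3))
        + Real.sin s * Real.cos s * Complex.I / (2 * m + 1) := by
  have hinv : ∀ j, expFreq j s * expFreq j (-s) = 1 := fun j => by
    rw [← expFreq_add, add_neg_cancel, expFreq_zero]
  have hz : expFreq 1 s = (Real.cos s : ℂ) + (Real.sin s : ℂ) * Complex.I := by
    simpa only [Nat.cast_one, one_mul] using expFreq_eq 1 s
  have hsc : (Real.sin s : ℂ) ^ 2 + (Real.cos s : ℂ) ^ 2 = 1 := by
    exact_mod_cast Real.sin_sq_add_cos_sq s
  have he0 : expFreq 0 s = 1 := by simp [expFreq]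
  have hw : expFreq 2 s = expFreq 1 s ^ 2 := by rw [sq, ← expFreq_add_freq]
  induction m with
  | zero =>
    have h := hinv 1
    simp only [cotExpPrim, Finset.range_zero, Finset.sum_empty, add_zero, mul_zero, zero_add, h,
      Finset.range_one, Finset.sum_singleton, Nat.cast_zero, he0, Nat.sub_self]
    rw [hz]
    linear_combination hsc
  | succ m ih =>
    have hS : ∑ n ∈ Finset.range (m + 1 + 1), expFreq (2 * (m + 1 - n)) s /
          ((2 * (n : ℂ) - 1) * (2 * n + 1) * (2 * n + 3)) =
        expFreq 2 s * (∑ n ∈ Finset.range (m + 1), expFreq (2 * (m - n)) s /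
          ((2 * (n : ℂ) - 1) * (2 * n + 1) * (2 * n + 3)))
          + 1 / ((2 * m + 1) * (2 * m + 3) * (2 * m + 5)) := by
      rw [Finset.sum_range_succ, Finset.mul_sum]
      congr 1
      · refine Finset.sum_congr rfl fun n hn => ?_
        rw [Finset.mem_range] at hn
        rw [show 2 * (m + 1 - n) = 2 + 2 * (m - n) by omega, expFreq_add_freq, mul_div_assoc]
      · rw [Nat.sub_self, mul_zero, he0]; push_cast; ring
    have he : expFreq (2 * (m + 1) + 1) s = expFreq 2 s * expFreq (2 * m + 1) s := by
      rw [← expFreq_add_freq]; congr 1; ring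
    have hK : expFreq (2 * (m + 1) + 1) s * cotExpPrim (m + 1) (-s) =
        expFreq 2 s * (expFreq (2 * m + 1) s * cotExpPrim m (-s))
          + 1 / (2 * m + 3) + expFreq 2 s / (2 * m + 1) := by
      have h3 : expFreq 2 s * expFreq (2 * m + 1) s * expFreq (2 * m + 3) (-s) = 1 := by
        rw [← he]; exact hinv (2 * m + 3)
      rw [cotExpPrim_succ, he]
      linear_combination (1 / (2 * (m : ℂ) + 3)) * h3
        + (expFreq 2 s / (2 * (m : ℂ) + 1)) * hinv (2 * m + 1)
    rw [hK, hS, he, mul_add, mul_add, mul_left_comm, ih]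
    have h1 := two_mul_add_one_ne m
    have h3 := two_mul_add_three_ne m
    have h5 : 2 * (m : ℂ) + 5 ≠ 0 := by
      have := two_mul_add_three_ne (m + 1)
      intro h
      apply this
      push_cast
      linear_combination h
    rw [show 2 * ((m + 1 : ℕ) : ℂ) + 1 = 2 * m + 3 by push_cast; ring,
      show 2 * ((m + 1 : ℕ) : ℂ) + 3 = 2 * m + 5 by push_cast; ring, hw, hz]
    generalize (Real.cos s : ℂ) = c at *
    generalize (Real.sin s : ℂ) = d at *
    generalize expFreq (2 * m + 1) s = e at *
    generalize ∑ n ∈ Finset.range (m + 1), expFreq (2 * (m - n)) s /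
          ((2 * (n : ℂ) - 1) * (2 * n + 1) * (2 * n + 3)) = S at *
    -- With `z = e^{is}` this reads `z² · (i d z⁻¹) = i d z`.
    have g1 : (c + d * Complex.I) ^ 2 * (d ^ 2 + d * c * Complex.I) =
        Complex.I * d * c - d ^ 2 := by
      linear_combination ((c + d * Complex.I) ^ 2 * d ^ 2
        - Complex.I * d * (c + d * Complex.I) * d ^ 2 + d ^ 2) * Complex.I_sq
        + Complex.I * d * (c + d * Complex.I) * hsc
    have g2 : (c + d * Complex.I) ^ 2 = 1 + 2 * Complex.I * d * c - 2 * d ^ 2 := by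
      linear_combination hsc + d ^ 2 * Complex.I_sq
    generalize (c + d * Complex.I) ^ 2 = w at *
    have g3 : w * (-1 / ((2 * m + 1) * (2 * m + 3)) + d * c * Complex.I / (2 * m + 1))
        + d ^ 2 / (2 * m + 3) + d ^ 2 * w / (2 * m + 1) =
        -1 / ((2 * m + 3) * (2 * m + 5)) - 4 / ((2 * m + 1) * (2 * m + 3) * (2 * m + 5))
          + d * c * Complex.I / (2 * m + 3) := by
      field_simp
      linear_combination (2 * (m : ℂ) + 5) * ((2 * m + 3) * g1 - g2)
    linear_combination g3

/-- All frequencies are odd. Hence the contributions of the two ends add up instead of cancelling.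
-/
theorem cotExpPrim_pi_add (m : ℕ) (x : ℝ) : cotExpPrim m (Real.pi + x) = -cotExpPrim m x := by
  have h : ∀ j, expFreq (2 * j + 1) (Real.pi + x) = -expFreq (2 * j + 1) x := fun j => by
    rw [expFreq_add, expFreq_odd_pi, neg_one_mul]
  have h3 : ∀ j, expFreq (2 * j + 3) (Real.pi + x) = -expFreq (2 * j + 3) x := fun j => h (j + 1)
  have h1 : expFreq 1 (Real.pi + x) = -expFreq 1 x := h 0
  simp only [cotExpPrim, h, h3, h1, neg_add, ← Finset.sum_neg_distrib, neg_div]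

theorem logTanHalf_neg_sub {s : ℝ} (hs : s ∈ Set.Ioo 0 Real.pi) :
    logTanHalf (-s) - logTanHalf (Real.pi - s) = -2 * Real.log |Real.cot (s / 2)| := by
  have hsin : 0 < Real.sin (s / 2) :=
    Real.sin_pos_of_pos_of_lt_pi (by linarith [hs.1]) (by linarith [hs.1, hs.2])
  have hcos : 0 < Real.cos (s / 2) :=
    Real.cos_pos_of_mem_Ioo ⟨by linarith [hs.1, hs.2], by linarith [hs.2]⟩
  have e : Real.cos s = 2 * Real.cos (s / 2) ^ 2 - 1 := by
    rw [← Real.cos_two_mul, mul_div_cancel₀ s two_ne_zero]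
  have e1 : 1 + Real.cos s = 2 * Real.cos (s / 2) ^ 2 := by rw [e]; ring
  have e2 : 1 + -Real.cos s = 2 * Real.sin (s / 2) ^ 2 := by
    rw [e]; linear_combination (-2) * Real.sin_sq_add_cos_sq (s / 2)
  rw [logTanHalf, logTanHalf, Real.sin_neg, Real.log_neg_eq_log, Real.cos_neg, Real.sin_pi_sub,
    Real.cos_pi_sub, e1, e2, Real.log_abs, Real.cot_eq_cos_div_sin,
    Real.log_div hcos.ne' hsin.ne', Real.log_mul two_ne_zero (by positivity),
    Real.log_mul two_ne_zero (by positivity), Real.log_pow, Real.log_pow]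
  push_cast
  ring

theorem tendsto_setIntegral_expFreq_arccot (m : ℕ) {s : ℝ} (hs : s ∈ Set.Ioo 0 Real.pi) :
    Tendsto (fun ε : ℝ => ∫ y in {y : ℝ | ε < |y|},
      (expFreq (2 * m + 1) (arccot (Real.cot s)) -
        expFreq (2 * m + 1) (arccot (Real.cot s + y))) / (y : ℂ) ^ 2) (𝓝[>] 0)
      (𝓝 (-(2 * (2 * m + 1) * Complex.I * expFreq (2 * m + 1) s *
          (Real.cos s + Real.sin s ^ 2 * Real.log |Real.cot (s / 2)|))
        - 2 * Complex.I / (2 * m + 3)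
        - 8 * (2 * m + 1) * Complex.I * ∑ n ∈ Finset.range (m + 1), expFreq (2 * (m - n)) s /
          ((2 * n - 1) * (2 * n + 1) * (2 * n + 3)))) := by
  have hsin := (Real.sin_pos_of_mem_Ioo hs).ne'
  have hinvT : Tendsto (fun y : ℝ => (y : ℂ)⁻¹) atTop (𝓝 0) := by
    simpa [Function.comp_def] using (Complex.continuous_ofReal.tendsto 0).comp tendsto_inv_atTop_zero
  have hinvB : Tendsto (fun y : ℝ => (y : ℂ)⁻¹) atBot (𝓝 0) := by
    simpa [Function.comp_def] using (Complex.continuous_ofReal.tendsto 0).comp tendsto_inv_atBot_zero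
  have hA := tendsto_quotPrim_of_arccot m (s := s) hinvT
    (tendsto_arccot_atTop.comp (tendsto_atTop_add_const_left _ _ tendsto_id))
    (by simpa using hsin)
    (one_add_cos_pos (by linarith [hs.2]) (by linarith [hs.1, hs.2])).ne'
  have hB := tendsto_quotPrim_of_arccot m (s := s) hinvB
    (tendsto_arccot_atBot.comp (tendsto_atBot_add_const_left _ _ tendsto_id))
    (by simpa using hsin)
    (one_add_cos_pos (by linarith [hs.1, hs.2]) (by linarith [hs.1, hs.2])).ne'
  have := tendsto_setIntegral_lt_abs
    (f := fun y : ℝ => (expFreq (2 * m + 1) (arccot (Real.cot s)) -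
        expFreq (2 * m + 1) (arccot (Real.cot s + y))) / (y : ℂ) ^ 2)
    (fun ε hε => integrableOn_sub_div_sq ((continuous_expFreq (2 * m + 1)).comp continuous_arccot)
      (fun t => (norm_expFreq _ _).le) (Real.cot s) hε)
    (fun y hy => by rw [arccot_cot hs]; exact hasDerivAt_quotPrim m hs hy) hA hB
    (tendsto_quotPrim_neg_sub m hs)
  convert this using 2
  have hlog := congrArg Complex.ofReal (logTanHalf_neg_sub hs)
  push_cast at hlog
  have halg := sin_sq_mul_cotExpPrim m s
  have hpi := cotExpPrim_pi_add m (-s)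
  rw [← sub_eq_add_neg] at hpi
  rw [zero_sub, hpi, expFreq_zero, expFreq_odd_pi]
  have h1 := two_mul_add_one_ne m
  have h3 := two_mul_add_three_ne m
  have e1 : (2 * (m : ℂ) + 1) * (1 / ((2 * m + 1) * (2 * m + 3))) = 1 / (2 * m + 3) := by
    field_simp
  have e2 : (2 * (m : ℂ) + 1) * (Real.sin s * Real.cos s * Complex.I / (2 * m + 1)) =
      Real.sin s * Real.cos s * Complex.I := by
    field_simp
  linear_combination (-(2 * (2 * m + 1) * Complex.I)) * halg
    - (Real.sin s ^ 2 * ((2 * m + 1) * Complex.I) * expFreq (2 * m + 1) s) * hlog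
    + 2 * Complex.I * e1 - 2 * Complex.I * e2 - 2 * Real.sin s * Real.cos s * Complex.I_sq

/-! ### Real and imaginary parts -/

theorem fracLaplConst_one : fracLaplConst 1 = 1 / Real.pi := by
  rw [fracLaplConst]
  norm_num [Real.Gamma_one_half_eq, Real.Gamma_one]
  rw [← mul_inv, Real.mul_self_sqrt Real.pi_pos.le]

/-- A continuous real-linear `g` commutes with the integral and the limit; `g` will be `Re` or `Im`.
-/
theorem hasFracLaplacianAt_one_comp_clm (g : ℂ →L[ℝ] ℝ) {u : ℝ → ℂ} {x : ℝ} {V : ℂ}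
    (hi : ∀ ε : ℝ, 0 < ε →
      IntegrableOn (fun y : ℝ => (u x - u (x + y)) / (y : ℂ) ^ 2) {y : ℝ | ε < |y|})
    (hV : Tendsto (fun ε : ℝ => ∫ y in {y : ℝ | ε < |y|}, (u x - u (x + y)) / (y : ℂ) ^ 2)
      (𝓝[>] 0) (𝓝 V)) :
    HasFracLaplacianAt 1 (fun t => g (u t)) x (1 / Real.pi * g V) := by
  have hg : (fun y : ℝ => (g (u x) - g (u (x + y))) / |y| ^ ((1 : ℝ) + 1)) =
      fun y : ℝ => g ((u x - u (x + y)) / (y : ℂ) ^ 2) := by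
    ext y
    have : (u x - u (x + y)) / (y : ℂ) ^ 2 = (y ^ 2)⁻¹ • (u x - u (x + y)) := by
      rw [Complex.real_smul]; push_cast; ring
    rw [this, map_smul, map_sub, one_add_one_eq_two, Real.rpow_two, sq_abs, smul_eq_mul]
    ring
  refine ⟨fun ε hε => ?_, ?_⟩
  · simp only [hg]
    exact g.integrable_comp (hi ε hε)
  · simp only [hg, fracLaplConst_one]
    refine Tendsto.const_mul _ (((g.continuous.tendsto V).comp hV).congr' ?_)
    filter_upwards [self_mem_nhdsWithin] with ε hε
    exact (g.integral_comp_comm (hi ε hε)).symm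

theorem hasHalfLaplacianS_clm_expFreq (g : ℂ →L[ℝ] ℝ) (m : ℕ) {s : ℝ}
    (hs : s ∈ Set.Ioo 0 Real.pi) :
    HasHalfLaplacianS 1 (fun t => g (expFreq (2 * m + 1) t)) s
      (1 / Real.pi * g (-(2 * (2 * m + 1) * Complex.I * expFreq (2 * m + 1) s *
          (Real.cos s + Real.sin s ^ 2 * Real.log |Real.cot (s / 2)|))
        - 2 * Complex.I / (2 * m + 3)
        - 8 * (2 * m + 1) * Complex.I * ∑ n ∈ Finset.range (m + 1), expFreq (2 * (m - n)) s /
          ((2 * n - 1) * (2 * n + 1) * (2 * n + 3)))) := by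
  rw [HasHalfLaplacianS]
  simp only [div_one, one_mul]
  exact hasFracLaplacianAt_one_comp_clm g (u := fun x => expFreq (2 * m + 1) (arccot x))
    (fun ε hε => integrableOn_sub_div_sq ((continuous_expFreq (2 * m + 1)).comp continuous_arccot)
      (fun t => (norm_expFreq _ _).le) (Real.cot s) hε)
    (tendsto_setIntegral_expFreq_arccot m hs)

theorem sum_expFreq_div (m : ℕ) (s : ℝ) :
    ∑ n ∈ Finset.range (m + 1), expFreq (2 * (m - n)) s /
        ((2 * (n : ℂ) - 1) * (2 * n + 1) * (2 * n + 3)) =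
      ((∑ n ∈ Finset.range (m + 1), Real.cos (((2 * m + 1 : ℕ) - 1 - 2 * (n : ℝ)) * s) /
        ((2 * (n : ℝ) - 1) * (2 * (n : ℝ) + 1) * (2 * (n : ℝ) + 3)) : ℝ) : ℂ)
      + ((∑ n ∈ Finset.range (m + 1), Real.sin (((2 * m + 1 : ℕ) - 1 - 2 * (n : ℝ)) * s) /
        ((2 * (n : ℝ) - 1) * (2 * (n : ℝ) + 1) * (2 * (n : ℝ) + 3)) : ℝ) : ℂ) * Complex.I := by
  rw [Complex.ofReal_sum, Complex.ofReal_sum, Finset.sum_mul, ← Finset.sum_add_distrib]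
  refine Finset.sum_congr rfl fun n hn => ?_
  have hn' : n ≤ m := by rw [Finset.mem_range] at hn; omega
  have e : ((2 * m + 1 : ℕ) - 1 - 2 * (n : ℝ)) * s = ((2 * (m - n) : ℕ) : ℝ) * s := by
    push_cast [Nat.cast_sub hn']; ring
  rw [e, expFreq_eq, Complex.ofReal_div, Complex.ofReal_div]
  push_cast
  ring

theorem halfLaplacian_cos_sin_of_mem_Ioo (m : ℕ) {s : ℝ} (hs : s ∈ Set.Ioo 0 Real.pi) :
    HasHalfLaplacianS 1 (fun t : ℝ => Real.cos ((2 * m + 1 : ℕ) * t)) s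
      (2 * ((2 * m + 1 : ℕ) : ℝ) / Real.pi * Real.sin ((2 * m + 1 : ℕ) * s) *
          (Real.cos s + Real.sin s ^ 2 * Real.log |Real.cot (s / 2)|)
        + 8 * ((2 * m + 1 : ℕ) : ℝ) / Real.pi * ∑ n ∈ Finset.range (m + 1),
          Real.sin (((2 * m + 1 : ℕ) - 1 - 2 * (n : ℝ)) * s) /
            ((2 * (n : ℝ) - 1) * (2 * (n : ℝ) + 1) * (2 * (n : ℝ) + 3))) ∧
    HasHalfLaplacianS 1 (fun t : ℝ => Real.sin ((2 * m + 1 : ℕ) * t)) s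
      (-(2 / (Real.pi * ((2 * m + 1 : ℕ) + 2)))
        - 2 * ((2 * m + 1 : ℕ) : ℝ) / Real.pi * Real.cos ((2 * m + 1 : ℕ) * s) *
          (Real.cos s + Real.sin s ^ 2 * Real.log |Real.cot (s / 2)|)
        - 8 * ((2 * m + 1 : ℕ) : ℝ) / Real.pi * ∑ n ∈ Finset.range (m + 1),
          Real.cos (((2 * m + 1 : ℕ) - 1 - 2 * (n : ℝ)) * s) /
            ((2 * (n : ℝ) - 1) * (2 * (n : ℝ) + 1) * (2 * (n : ℝ) + 3))) := by
  have hre := hasHalfLaplacianS_clm_expFreq Complex.reCLM m hs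
  have him := hasHalfLaplacianS_clm_expFreq Complex.imCLM m hs
  rw [sum_expFreq_div, expFreq_eq (2 * m + 1) s] at hre him
  generalize Finset.sum _ (fun n : ℕ => Real.cos _ / _) = C at *
  generalize Finset.sum _ (fun n : ℕ => Real.sin _ / _) = S at *
  have hfre : (fun t => Complex.reCLM (expFreq (2 * m + 1) t)) =
      fun t : ℝ => Real.cos ((2 * m + 1 : ℕ) * t) := by
    ext t; rw [expFreq_eq]; simp [-Complex.ofReal_cos, -Complex.ofReal_sin]
  have hfim : (fun t => Complex.imCLM (expFreq (2 * m + 1) t)) =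
      fun t : ℝ => Real.sin ((2 * m + 1 : ℕ) * t) := by
    ext t; rw [expFreq_eq]; simp [-Complex.ofReal_cos, -Complex.ofReal_sin]
  rw [hfre] at hre
  rw [hfim] at him
  generalize Real.log |Real.cot (s / 2)| = L at *
  have hV : -(2 * (2 * (m : ℂ) + 1) * Complex.I * ((Real.cos ((2 * m + 1 : ℕ) * s) : ℂ)
        + (Real.sin ((2 * m + 1 : ℕ) * s) : ℂ) * Complex.I) *
          (Real.cos s + Real.sin s ^ 2 * L))
        - 2 * Complex.I / (2 * m + 3)
        - 8 * (2 * m + 1) * Complex.I * (C + S * Complex.I) =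
      ((2 * (2 * m + 1) * Real.sin ((2 * m + 1 : ℕ) * s) * (Real.cos s + Real.sin s ^ 2 * L)
        + 8 * (2 * m + 1) * S : ℝ) : ℂ)
      + ((-(2 / (2 * m + 3)) - 2 * (2 * m + 1) * Real.cos ((2 * m + 1 : ℕ) * s) *
          (Real.cos s + Real.sin s ^ 2 * L) - 8 * (2 * m + 1) * C : ℝ) : ℂ) * Complex.I := by
    generalize Real.cos ((2 * m + 1 : ℕ) * s) = c'
    generalize Real.sin ((2 * m + 1 : ℕ) * s) = d'
    push_cast
    linear_combination (-(2 * (2 * (m : ℂ) + 1) * d' * (Complex.cos s + Complex.sin s ^ 2 * L))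
      - 8 * (2 * m + 1) * S) * Complex.I_sq
  rw [hV] at hre him
  have hπ := Real.pi_pos.ne'
  have h3 : (2 * (m : ℝ) + 3) ≠ 0 := by positivity
  constructor
  · convert hre using 1
    rw [Complex.reCLM_apply, ← Complex.mk_eq_add_mul_I]
    push_cast
    ring
  · convert him using 1
    rw [Complex.imCLM_apply, ← Complex.mk_eq_add_mul_I]
    have e : (((2 * m + 1 : ℕ) : ℝ) + 2) = 2 * m + 3 := by push_cast; ring
    rw [e]
    push_cast
    field_simp

/-! ### Extension to negative `s` by periodicity -/

theorem log_abs_cot_half_add_pi (s : ℝ) :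
    Real.log |Real.cot ((s + Real.pi) / 2)| = -Real.log |Real.cot (s / 2)| := by
  rw [Real.log_abs, Real.log_abs, Real.cot_eq_cos_div_sin, Real.cot_eq_cos_div_sin, add_div,
    Real.cos_add_pi_div_two, Real.sin_add_pi_div_two, neg_div, Real.log_neg_eq_log, ← Real.log_inv,
    inv_div]

theorem cot_add_pi (s : ℝ) : Real.cot (s + Real.pi) = Real.cot s := by
  rw [Real.cot_eq_cos_div_sin, Real.cot_eq_cos_div_sin, Real.cos_add_pi, Real.sin_add_pi,
    neg_div_neg_eq]

theorem mainTheorem5 (k : ℕ) (hk : Odd k) (s : ℝ)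
    (hs : s ∈ Set.Ioo (-Real.pi) 0 ∪ Set.Ioo 0 Real.pi) :
    HasHalfLaplacianS 1 (fun t : ℝ => Real.cos ((k : ℝ) * t)) s
      (2 * (k : ℝ) / Real.pi * Real.sin ((k : ℝ) * s) *
          (Real.cos s + Real.sin s ^ 2 * Real.log |Real.cot (s / 2)|)
        + 8 * (k : ℝ) / Real.pi *
          ∑ n ∈ Finset.range ((k - 1) / 2 + 1),
            Real.sin (((k : ℝ) - 1 - 2 * (n : ℝ)) * s) /
              ((2 * (n : ℝ) - 1) * (2 * (n : ℝ) + 1) * (2 * (n : ℝ) + 3))) ∧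
    HasHalfLaplacianS 1 (fun t : ℝ => Real.sin ((k : ℝ) * t)) s
      (-(2 / (Real.pi * ((k : ℝ) + 2)))
        - 2 * (k : ℝ) / Real.pi * Real.cos ((k : ℝ) * s) *
          (Real.cos s + Real.sin s ^ 2 * Real.log |Real.cot (s / 2)|)
        - 8 * (k : ℝ) / Real.pi *
          ∑ n ∈ Finset.range ((k - 1) / 2 + 1),
            Real.cos (((k : ℝ) - 1 - 2 * (n : ℝ)) * s) /
              ((2 * (n : ℝ) - 1) * (2 * (n : ℝ) + 1) * (2 * (n : ℝ) + 3))) := by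
  obtain ⟨m, rfl⟩ := hk
  rw [Nat.add_sub_cancel, Nat.mul_div_cancel_left m two_pos]
  rcases hs with hs | hs
  -- Both formulas are `π`-periodic: for odd `k`, the factor in `k s`, `cos s` and the logarithm all
  -- change sign, while the sums contain only even frequencies.
  · have h := halfLaplacian_cos_sin_of_mem_Ioo m (s := s + Real.pi)
      ⟨by linarith [hs.1], by linarith [hs.2]⟩
    have hk : ((2 * m + 1 : ℕ) : ℝ) * (s + Real.pi) =
        (2 * m + 1 : ℕ) * s + Real.pi + (m : ℝ) * (2 * Real.pi) := by
      push_cast; ring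
    have hj : ∀ n : ℕ, (((2 * m + 1 : ℕ) : ℝ) - 1 - 2 * (n : ℝ)) * (s + Real.pi) =
        ((2 * m + 1 : ℕ) - 1 - 2 * (n : ℝ)) * s + ((m - n : ℤ) : ℝ) * (2 * Real.pi) := by
      intro n; push_cast; ring
    unfold HasHalfLaplacianS at h ⊢
    simp only [cot_add_pi, log_abs_cot_half_add_pi, hk, hj, Real.cos_add_int_mul_two_pi,
      Real.sin_add_int_mul_two_pi, Real.cos_add_nat_mul_two_pi, Real.sin_add_nat_mul_two_pi,
      Real.cos_add_pi, Real.sin_add_pi] at h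
    convert h using 2 <;> ring
  · exact halfLaplacian_cos_sin_of_mem_Ioo m hs
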